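/- Let $F$ be Thompson's group: the group of all strictly increasing piecewise linear homeomorphisms of $[0,1]$ that are differentiable except at finitely many dyadic rationals and whose slopes are integer powers of $2$. Let $x_0,x_1\in F$ be its standard generators, $$x_0(t)=\begin{cases}\frac t2,&0\le t\le\frac12,\\ t-\frac14,&\frac12\le t\le\frac34,\\ 2t-1,&\frac34\le t\le1,\end{cases}\qquad x_1(t)=\begin{cases}t,&0\le t\le\frac12,\\ \frac t2+\frac14,&\frac12\le t\le\frac34,\\ t-\frac18,&\frac34\le t\le\frac78,\\ 2t-1,&\frac78\le t\le1.\end{cases}$$ For $x\in[0,1]$ let $\Gamma_x$ be the Schreier graph of the action of $F$ on the orbit of $x$: its vertices are the points of the orbit $Fx$, and for every vertex $y$ and $i\in\{0,1\}$ there is one arrow, labelled $x_i$, from $y$ to $x_i(y)$ (loops and multiple arrows are kept). **Theorem.** For every $x\in(0,1)$ the automorphism group of $\Gamma_x$ is trivial, in both of the following senses. 1. (Marked graph.) The only permutation of the vertices that is induced by an automorphism of the directed labelled graph $\Gamma_x$ is the identity. 2. (Unmarked graph.) The same holds after labels and directions are forgotten: the only permutation $\sigma$ of the vertices that is induced by an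 automorphism of the underlying undirected multigraph (i.e. for which there is a permutation $\tau$ of the edges such that, for every edge $e$ with end points $u,v$, the edge $\tau(e)$ has end points $\sigma(u),\sigma(v)$) is the identity. -/

import Mathlib

noncomputable section

/-! ## Thompson's group `F` acting on the unit interval -/

/-- A real number of the form `m / 2 ^ n` with `m` an integer and `n` a natural number. -/
def IsDyadic (r : ℝ) : Prop := ∃ (m : ℤ) (n : ℕ), r = m / 2 ^ n

/-- Membership in Thompson's group `F`: a strictly increasing homeomorphism `f` of `[0,1]` for
which there is a finite set `B` of dyadic rationals such that, on every closed interval with no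
point of `B` in its interior, `f` is affine with slope an integer power of `2`. -/
def IsThompson (f : unitInterval ≃ₜ unitInterval) : Prop :=
  StrictMono f ∧ ∃ B : Finset unitInterval, (∀ c ∈ B, IsDyadic (c : ℝ)) ∧
    ∀ a b : unitInterval, a ≤ b → (∀ c ∈ B, ¬ (a < c ∧ c < b)) →
      ∃ k : ℤ, ∀ s ∈ Set.Icc a b, ∀ t ∈ Set.Icc a b,
        (f t : ℝ) - (f s : ℝ) = (2 : ℝ) ^ k * ((t : ℝ) - (s : ℝ))

theorem IsDyadic.add {r s : ℝ} (hr : IsDyadic r) (hs : IsDyadic s) : IsDyadic (r + s) := by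
  obtain ⟨m, n, rfl⟩ := hr
  obtain ⟨m', n', rfl⟩ := hs
  refine ⟨m * 2 ^ n' + m' * 2 ^ n, n + n', ?_⟩
  push_cast
  rw [pow_add]
  field_simp

theorem IsDyadic.neg {r : ℝ} (hr : IsDyadic r) : IsDyadic (-r) := by
  obtain ⟨m, n, rfl⟩ := hr
  exact ⟨-m, n, by push_cast; ring⟩

theorem IsDyadic.zpow_mul {r : ℝ} (hr : IsDyadic r) (k : ℤ) : IsDyadic ((2 : ℝ) ^ k * r) := by
  obtain ⟨m, n, rfl⟩ := hr
  obtain ⟨j, rfl | rfl⟩ := k.eq_nat_or_neg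
  · exact ⟨2 ^ j * m, n, by push_cast; rw [zpow_natCast]; ring⟩
  · refine ⟨m, n + j, ?_⟩
    rw [zpow_neg, zpow_natCast, pow_add]
    field_simp

theorem isDyadic_zero : IsDyadic 0 := ⟨0, 0, by simp⟩

theorem IsThompson.map_zero {f : unitInterval ≃ₜ unitInterval} (hf : IsThompson f) : f 0 = 0 := by
  apply le_antisymm _ unitInterval.nonneg'
  have h := hf.1.monotone (unitInterval.nonneg' (t := f.symm 0))
  rwa [f.apply_symm_apply] at h

theorem IsThompson.isDyadic_iff {f : unitInterval ≃ₜ unitInterval} (hf : IsThompson f)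
    (t : unitInterval) : IsDyadic (f t : ℝ) ↔ IsDyadic (t : ℝ) := by
  obtain ⟨-, B, hB, hl⟩ := id hf
  have key : ∀ a t : unitInterval, a ≤ t → (∀ c ∈ B, ¬ (a < c ∧ c < t)) →
      IsDyadic (a : ℝ) → IsDyadic (f a : ℝ) → (IsDyadic (f t : ℝ) ↔ IsDyadic (t : ℝ)) := by
    intro a t hat hc ha hfa
    obtain ⟨k, hk⟩ := hl a t hat hc
    have h := hk a ⟨le_rfl, hat⟩ t ⟨hat, le_rfl⟩
    constructor
    · intro ht
      have h2 : (t : ℝ) = (2 : ℝ) ^ (-k) * ((f t : ℝ) + -(f a : ℝ)) + a := by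
        rw [← sub_eq_add_neg, h, ← mul_assoc, ← zpow_add₀ (by norm_num)]
        simp
      rw [h2]
      exact ((ht.add hfa.neg).zpow_mul _).add ha
    · intro ht
      have h2 : (f t : ℝ) = (2 : ℝ) ^ k * ((t : ℝ) + -(a : ℝ)) + f a := by
        rw [← sub_eq_add_neg, ← h]; ring
      rw [h2]
      exact ((ht.add ha.neg).zpow_mul _).add hfa
  induction hn : (B.filter (· < t)).card using Nat.strong_induction_on generalizing t with
  | _ n ih =>
    by_cases hne : (B.filter (· < t)).Nonempty
    · have hmem := Finset.max'_mem _ hne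
      set a := (B.filter (· < t)).max' hne with ha
      rw [Finset.mem_filter] at hmem
      have hda : IsDyadic (a : ℝ) := hB a hmem.1
      have hlt : (B.filter (· < a)).card < n := by
        rw [← hn]
        apply Finset.card_lt_card
        refine ⟨fun c hc => ?_, fun hs => ?_⟩
        · rw [Finset.mem_filter] at hc ⊢
          exact ⟨hc.1, hc.2.trans hmem.2⟩
        · have := hs (Finset.mem_filter.2 hmem)
          exact lt_irrefl _ (Finset.mem_filter.1 this).2
      refine key a t hmem.2.le (fun c hc h => ?_) hda ((ih _ hlt a rfl).2 hda)
      exact absurd (Finset.le_max' _ c (Finset.mem_filter.2 ⟨hc, h.2⟩)) (not_le.2 h.1)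
    · refine key 0 t unitInterval.nonneg' (fun c hc h => ?_) (by simpa using isDyadic_zero)
        (by rw [hf.map_zero]; simpa using isDyadic_zero)
      exact hne ⟨c, Finset.mem_filter.2 ⟨hc, h.2⟩⟩

theorem IsThompson.one : IsThompson 1 :=
  ⟨fun _ _ h => h, ∅, by simp, fun _ _ _ _ => ⟨0, fun s _ t _ => by simp⟩⟩

theorem IsThompson.mul {g f : unitInterval ≃ₜ unitInterval} (hg : IsThompson g)
    (hf : IsThompson f) : IsThompson (g * f) := by
  classical
  obtain ⟨hgm, Bg, hBg, hlg⟩ := id hg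
  obtain ⟨hfm, Bf, hBf, hlf⟩ := id hf
  refine ⟨hgm.comp hfm, Bf ∪ Bg.image f.symm, ?_, ?_⟩
  · intro c hc
    rcases Finset.mem_union.1 hc with hc | hc
    · exact hBf c hc
    · obtain ⟨d, hd, rfl⟩ := Finset.mem_image.1 hc
      rw [← hf.isDyadic_iff, f.apply_symm_apply]
      exact hBg d hd
  · intro a b hab hc
    obtain ⟨k, hk⟩ := hlf a b hab fun c h => hc c (Finset.mem_union_left _ h)
    obtain ⟨l, hl⟩ := hlg (f a) (f b) (hfm.monotone hab) fun c h h' =>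
      hc (f.symm c) (Finset.mem_union_right _ (Finset.mem_image_of_mem _ h))
        ⟨hfm.lt_iff_lt.1 (by simpa using h'.1), hfm.lt_iff_lt.1 (by simpa using h'.2)⟩
    refine ⟨l + k, fun s hs t ht => ?_⟩
    have h := hl (f s) ⟨hfm.monotone hs.1, hfm.monotone hs.2⟩ (f t)
      ⟨hfm.monotone ht.1, hfm.monotone ht.2⟩
    rw [hk s hs t ht, ← mul_assoc, ← zpow_add₀ (by norm_num)] at h
    exact h

theorem IsThompson.inv {f : unitInterval ≃ₜ unitInterval} (hf : IsThompson f) :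
    IsThompson f⁻¹ := by
  classical
  obtain ⟨hfm, B, hB, hl⟩ := id hf
  have hm : StrictMono f.symm := fun a b hab => hfm.lt_iff_lt.1 (by simpa using hab)
  refine ⟨hm, B.image f, ?_, ?_⟩
  · intro c hc
    obtain ⟨d, hd, rfl⟩ := Finset.mem_image.1 hc
    exact (hf.isDyadic_iff d).2 (hB d hd)
  · intro a b hab hc
    obtain ⟨k, hk⟩ := hl (f.symm a) (f.symm b) (hm.monotone hab) fun c h h' =>
      hc (f c) (Finset.mem_image_of_mem _ h)
        ⟨hm.lt_iff_lt.1 (by simpa using h'.1), hm.lt_iff_lt.1 (by simpa using h'.2)⟩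
    refine ⟨-k, fun s hs t ht => ?_⟩
    have h := hk (f.symm s) ⟨hm.monotone hs.1, hm.monotone hs.2⟩ (f.symm t)
      ⟨hm.monotone ht.1, hm.monotone ht.2⟩
    rw [f.apply_symm_apply, f.apply_symm_apply] at h
    rw [h, ← mul_assoc, ← zpow_add₀ (by norm_num)]
    simp

/-- Thompson's group `F`. -/
def thompsonF : Subgroup (unitInterval ≃ₜ unitInterval) where
  carrier := {f | IsThompson f}
  one_mem' := IsThompson.one
  mul_mem' := IsThompson.mul
  inv_mem' := IsThompson.inv

/-- The natural action of `F` on `[0,1]`. -/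
instance : MulAction thompsonF unitInterval where
  smul f t := f.1 t
  one_smul _ := rfl
  mul_smul _ _ _ := rfl

/-! ### The standard generators -/

/-- The generator `x₀` as a function of a real variable. -/
def x0Fun (t : ℝ) : ℝ := if t ≤ 1 / 2 then t / 2 else if t ≤ 3 / 4 then t - 1 / 4 else 2 * t - 1

/-- The generator `x₁` as a function of a real variable. -/
def x1Fun (t : ℝ) : ℝ :=
  if t ≤ 1 / 2 then t else if t ≤ 3 / 4 then t / 2 + 1 / 4
  else if t ≤ 7 / 8 then t - 1 / 8 else 2 * t - 1

/-- The inverse of `x0Fun`. -/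
def x0Inv (t : ℝ) : ℝ :=
  if t ≤ 1 / 4 then 2 * t else if t ≤ 1 / 2 then t + 1 / 4 else t / 2 + 1 / 2

/-- The inverse of `x1Fun`. -/
def x1Inv (t : ℝ) : ℝ :=
  if t ≤ 1 / 2 then t else if t ≤ 5 / 8 then 2 * t - 1 / 2
  else if t ≤ 3 / 4 then t + 1 / 8 else t / 2 + 1 / 2

/-- The homeomorphism `x₀` of `[0,1]`. -/
def x0Homeo : unitInterval ≃ₜ unitInterval :=
  (StrictMono.orderIsoOfRightInverse
    (fun t : unitInterval => (⟨x0Fun t, by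
      have := t.2.1; have := t.2.2; unfold x0Fun; constructor <;> split_ifs <;> linarith⟩ :
        unitInterval))
    (by
      intro s t h
      have h' : (s : ℝ) < t := h
      change x0Fun s < x0Fun t
      unfold x0Fun
      split_ifs <;> linarith)
    (fun t : unitInterval => (⟨x0Inv t, by
      have := t.2.1; have := t.2.2; unfold x0Inv; constructor <;> split_ifs <;> linarith⟩ :
        unitInterval))
    (by
      intro t
      apply Subtype.ext
      change x0Fun (x0Inv t) = t
      unfold x0Fun x0Inv
      split_ifs <;> linarith)).toHomeomorph

/-- The homeomorphism `x₁` of `[0,1]`. -/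
def x1Homeo : unitInterval ≃ₜ unitInterval :=
  (StrictMono.orderIsoOfRightInverse
    (fun t : unitInterval => (⟨x1Fun t, by
      have := t.2.1; have := t.2.2; unfold x1Fun; constructor <;> split_ifs <;> linarith⟩ :
        unitInterval))
    (by
      intro s t h
      have h' : (s : ℝ) < t := h
      change x1Fun s < x1Fun t
      unfold x1Fun
      split_ifs <;> linarith)
    (fun t : unitInterval => (⟨x1Inv t, by
      have := t.2.1; have := t.2.2; unfold x1Inv; constructor <;> split_ifs <;> linarith⟩ :
        unitInterval))
    (by
      intro t
      apply Subtype.ext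
      change x1Fun (x1Inv t) = t
      unfold x1Fun x1Inv
      split_ifs <;> linarith)).toHomeomorph

theorem coe_x0Homeo (t : unitInterval) : (x0Homeo t : ℝ) = x0Fun t := rfl

theorem coe_x1Homeo (t : unitInterval) : (x1Homeo t : ℝ) = x1Fun t := rfl

theorem isThompson_x0 : IsThompson x0Homeo := by
  classical
  refine ⟨OrderIso.strictMono _, {⟨1 / 2, by constructor <;> norm_num⟩,
    ⟨3 / 4, by constructor <;> norm_num⟩}, ?_, ?_⟩
  · intro c hc
    simp only [Finset.mem_insert, Finset.mem_singleton] at hc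
    rcases hc with rfl | rfl
    · exact ⟨1, 1, by norm_num⟩
    · exact ⟨3, 2, by norm_num⟩
  · intro a b hab hc
    simp only [Finset.mem_insert, Finset.mem_singleton, forall_eq_or_imp, forall_eq,
      ← Subtype.coe_lt_coe, not_and_or, not_lt] at hc
    simp only [Set.mem_Icc, ← Subtype.coe_le_coe, coe_x0Homeo, x0Fun]
    obtain ⟨h1, h2⟩ := hc
    rcases h1 with h1 | h1
    · rcases h2 with h2 | h2
      · exact ⟨1, fun s hs t ht => by rw [zpow_one]; split_ifs <;> linarith [hs.1, ht.1]⟩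
      · exact ⟨0, fun s hs t ht => by
          rw [zpow_zero]; split_ifs <;> linarith [hs.1, ht.1, hs.2, ht.2]⟩
    · exact ⟨-1, fun s hs t ht => by rw [zpow_neg_one]; split_ifs <;> linarith [hs.2, ht.2]⟩

theorem isThompson_x1 : IsThompson x1Homeo := by
  classical
  refine ⟨OrderIso.strictMono _, {⟨1 / 2, by constructor <;> norm_num⟩,
    ⟨3 / 4, by constructor <;> norm_num⟩, ⟨7 / 8, by constructor <;> norm_num⟩}, ?_, ?_⟩
  · intro c hc
    simp only [Finset.mem_insert, Finset.mem_singleton] at hc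
    rcases hc with rfl | rfl | rfl
    · exact ⟨1, 1, by norm_num⟩
    · exact ⟨3, 2, by norm_num⟩
    · exact ⟨7, 3, by norm_num⟩
  · intro a b hab hc
    simp only [Finset.mem_insert, Finset.mem_singleton, forall_eq_or_imp, forall_eq,
      ← Subtype.coe_lt_coe, not_and_or, not_lt] at hc
    simp only [Set.mem_Icc, ← Subtype.coe_le_coe, coe_x1Homeo, x1Fun]
    obtain ⟨h1, h2, h3⟩ := hc
    rcases h1 with h1 | h1
    · rcases h2 with h2 | h2
      · rcases h3 with h3 | h3
        · exact ⟨1, fun s hs t ht => by rw [zpow_one]; split_ifs <;> linarith [hs.1, ht.1]⟩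
        · exact ⟨0, fun s hs t ht => by
            rw [zpow_zero]; split_ifs <;> linarith [hs.1, ht.1, hs.2, ht.2]⟩
      · exact ⟨-1, fun s hs t ht => by
          rw [zpow_neg_one]; split_ifs <;> linarith [hs.1, ht.1, hs.2, ht.2]⟩
    · exact ⟨0, fun s hs t ht => by rw [zpow_zero]; split_ifs <;> linarith [hs.2, ht.2]⟩

/-- The generator `x₀` of `F`. -/
def genX0 : thompsonF := ⟨x0Homeo, isThompson_x0⟩

/-- The generator `x₁` of `F`. -/
def genX1 : thompsonF := ⟨x1Homeo, isThompson_x1⟩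

/-! ## Labelled directed graphs and their automorphisms -/

/-- A directed graph (loops and multiple arrows allowed) with vertex set `V`, set of arrows `E`,
and arrows labelled by `L`. -/
structure LabelledDigraph (V E L : Type*) where
  src : E → V
  tgt : E → V
  label : E → L

namespace LabelledDigraph

/-- The unordered pair of end points of an arrow; forgetting labels and directions, the graph
becomes the undirected multigraph with vertices `V`, edges `E` and these end points. -/
def endpoints {V E L : Type*} (Γ : LabelledDigraph V E L) (e : E) : Sym2 V :=
  s(Γ.src e, Γ.tgt e)

/-- The automorphism group of the marked graph: the permutations of the vertices that are
induced by an automorphism, i.e. that come with a permutation of the arrows respecting sources,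
targets and labels. -/
def markedAut {V E L : Type*} (Γ : LabelledDigraph V E L) : Subgroup (Equiv.Perm V) where
  carrier := {σ | ∃ τ : Equiv.Perm E, ∀ e, Γ.src (τ e) = σ (Γ.src e) ∧
    Γ.tgt (τ e) = σ (Γ.tgt e) ∧ Γ.label (τ e) = Γ.label e}
  one_mem' := ⟨1, by simp⟩
  mul_mem' := by
    rintro σ σ' ⟨τ, h⟩ ⟨τ', h'⟩
    exact ⟨τ * τ', fun e => by simp [h, h']⟩
  inv_mem' := by
    rintro σ ⟨τ, h⟩
    refine ⟨τ⁻¹, fun e => ?_⟩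
    have := h (τ.symm e)
    simp only [Equiv.apply_symm_apply] at this
    simp [this]

/-- The automorphism group of the underlying undirected multigraph (labels and directions
forgotten): the permutations of the vertices that are induced by an automorphism, i.e. that come
with a permutation of the edges respecting the unordered pairs of end points. -/
def unmarkedAut {V E L : Type*} (Γ : LabelledDigraph V E L) : Subgroup (Equiv.Perm V) where
  carrier := {σ | ∃ τ : Equiv.Perm E, ∀ e, Γ.endpoints (τ e) = (Γ.endpoints e).map σ}
  one_mem' := ⟨1, by simp⟩
  mul_mem' := by
    rintro σ σ' ⟨τ, h⟩ ⟨τ', h'⟩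
    exact ⟨τ * τ', fun e => by simp [h, h', Sym2.map_map]⟩
  inv_mem' := by
    rintro σ ⟨τ, h⟩
    refine ⟨τ⁻¹, fun e => ?_⟩
    have := h (τ.symm e)
    simp only [Equiv.apply_symm_apply] at this
    simp [this, Sym2.map_map]

end LabelledDigraph

/-! ## Schreier graphs -/

/-- The orbital Schreier graph of an action of `G` on `M` with respect to the elements `s i`:
the vertices are the points of `M`, and for every `m` and `i` there is one arrow, labelled `i`,
from `m` to the image of `m` under `s i`. -/
def schreierGraph {G M ι : Type*} [Group G] [MulAction G M] (s : ι → G) :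
    LabelledDigraph M (M × ι) ι where
  src e := e.1
  tgt e := s e.2 • e.1
  label e := e.2

/-- The Schreier graph `Γ_x` of the action of Thompson's group `F` on the orbit of `x ∈ [0,1]`
with respect to the generators `x₀` and `x₁`. -/
def thompsonSchreier (x : unitInterval) :
    LabelledDigraph (MulAction.orbit thompsonF x) (MulAction.orbit thompsonF x × Fin 2) (Fin 2) :=
  schreierGraph ![genX0, genX1]

end

/-! Only adjacency and loops are needed, not edge multiplicities, and marked automorphisms are
unmarked ones. Loops occur exactly on `(0, 1/2]`, where `x₁` is the identity. Starting from this,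
the cut points 1/2, 3/4, 7/8 and 5/8 can be read off from the unlabelled graph, so an automorphism
`σ` preserves each resulting region.

Near the middle the regions recover the labels: `σ` commutes with `x₁` on `(1/2, 3/4]` (`map_b_mid`)
and with both generators on `(3/4, 7/8]` (`map_a_and_b_high`). On `(1/2, 3/4]` the branches `x₁⁻¹`
and `x₀x₁⁻¹` form an expanding map of slope 2 commuting with `σ`. It doubles the displacement `σ v -
v`, which stays bounded, so `σ` is the identity there (`map_eq_self_mid`). The rest of the graph
hangs off this core along rays towards 0 and 1, and fixedness spreads along them by induction. -/

/-! ### Neighbours in each region of the interval. -/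

/-- Adjacency of two reals under `x0Fun` and `x1Fun`, regardless of direction and label. -/
def GenAdj (y z : ℝ) : Prop := z = x0Fun y ∨ y = x0Fun z ∨ z = x1Fun y ∨ y = x1Fun z

namespace GenAdj

theorem symm {y z : ℝ} (h : GenAdj y z) : GenAdj z y := by
  unfold GenAdj at *; tauto

/-- The loops come from `x₁`; `x₀` has no fixed point in `(0, 1)`. -/
theorem self_iff {y : ℝ} (h0 : 0 < y) (h1 : y < 1) : GenAdj y y ↔ y ≤ 1 / 2 := by
  unfold GenAdj x0Fun x1Fun
  constructor
  · rintro (h | h | h | h) <;> split_ifs at h <;> linarith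
  · intro h
    exact Or.inr (Or.inr (Or.inl (if_pos h).symm))

theorem eq_of_mid_of_low {y z : ℝ} (h : GenAdj y z) (hy : 1 / 2 < y) (hz0 : 0 < z)
    (hz : z ≤ 1 / 2) : y ≤ 3 / 4 ∧ z = y - 1 / 4 := by
  unfold GenAdj x0Fun x1Fun at h
  constructor <;> rcases h with (h | h | h | h) <;> split_ifs at h <;> linarith

theorem of_mid_mid {y z : ℝ} (h : GenAdj y z) (hy : 1 / 2 < y) (hy' : y ≤ 3 / 4)
    (hz : 1 / 2 < z) (hz' : z ≤ 3 / 4) : z = y / 2 + 1 / 4 ∨ y ≤ 5 / 8 ∧ z = 2 * y - 1 / 2 := by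
  unfold GenAdj x0Fun x1Fun at h
  rcases h with (h | h | h | h) <;> split_ifs at h <;>
    first | linarith | (left; linarith) | (right; constructor <;> linarith)

theorem of_mid_high {y z : ℝ} (h : GenAdj y z) (hy : 1 / 2 < y) (hy' : y ≤ 3 / 4)
    (hz : 3 / 4 < z) : z ≤ 7 / 8 ∧ (z = y / 2 + 1 / 2 ∨ 5 / 8 < y ∧ z = y + 1 / 8) := by
  unfold GenAdj x0Fun x1Fun at h
  rcases h with (h | h | h | h) <;> split_ifs at h <;> first | linarith | skip
  · exact ⟨by linarith, by left; linarith⟩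
  · exact ⟨by linarith, by right; constructor <;> linarith⟩

theorem of_high_high {y z : ℝ} (h : GenAdj y z) (hy : 3 / 4 < y) (hz : 3 / 4 < z) :
    z = 2 * y - 1 ∨ z = y / 2 + 1 / 2 := by
  unfold GenAdj x0Fun x1Fun at h
  rcases h with (h | h | h | h) <;> split_ifs at h <;>
    first | linarith | (left; linarith) | (right; linarith)

theorem of_low_low {y z : ℝ} (h : GenAdj y z) (hy : y ≤ 1 / 2) (hz : z ≤ 1 / 2) :
    z = y ∨ z = y / 2 ∨ z = 2 * y := by
  unfold GenAdj x0Fun x1Fun at h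
  rcases h with (h | h | h | h) <;> split_ifs at h <;>
    first | linarith | (left; linarith) | (right; left; linarith) | (right; right; linarith)

end GenAdj

/-- A set of points of `(0, 1)`, with coordinate function `c`, on which the generators `x₀` and
`x₁` act as permutations `a` and `b`. -/
structure GenModel (V : Type*) where
  c : V → ℝ
  a : Equiv.Perm V
  b : Equiv.Perm V
  inj : Function.Injective c
  pos : ∀ v, 0 < c v
  lt_one : ∀ v, c v < 1
  c_a : ∀ v, c (a v) = x0Fun (c v)
  c_b : ∀ v, c (b v) = x1Fun (c v)

namespace GenModel

variable {V : Type*} (M : GenModel V)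

theorem c_a_symm (v : V) : M.c (M.a.symm v) = x0Inv (M.c v) := by
  have h := M.c_a (M.a.symm v)
  rw [Equiv.apply_symm_apply] at h
  rw [h]
  unfold x0Inv x0Fun
  split_ifs <;> linarith

theorem c_b_symm (v : V) : M.c (M.b.symm v) = x1Inv (M.c v) := by
  have h := M.c_b (M.b.symm v)
  rw [Equiv.apply_symm_apply] at h
  rw [h]
  unfold x1Inv x1Fun
  split_ifs <;> linarith

theorem adj_a (v : V) : GenAdj (M.c v) (M.c (M.a v)) := Or.inl (M.c_a v)

theorem adj_b (v : V) : GenAdj (M.c v) (M.c (M.b v)) := Or.inr (Or.inr (Or.inl (M.c_b v)))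

theorem c_a_mid {v : V} (h : 1 / 2 < M.c v) (h' : M.c v ≤ 3 / 4) :
    M.c (M.a v) = M.c v - 1 / 4 := by
  rw [M.c_a, x0Fun, if_neg h.not_ge, if_pos h']

theorem c_a_high {v : V} (h : 3 / 4 < M.c v) : M.c (M.a v) = 2 * M.c v - 1 := by
  rw [M.c_a, x0Fun, if_neg (by linarith), if_neg h.not_ge]

theorem c_b_mid {v : V} (h : 1 / 2 < M.c v) (h' : M.c v ≤ 3 / 4) :
    M.c (M.b v) = M.c v / 2 + 1 / 4 := by
  rw [M.c_b, x1Fun, if_neg h.not_ge, if_pos h']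

theorem c_b_high {v : V} (h : 3 / 4 < M.c v) (h' : M.c v ≤ 7 / 8) :
    M.c (M.b v) = M.c v - 1 / 8 := by
  rw [M.c_b, x1Fun, if_neg (by linarith), if_neg h.not_ge, if_pos h']

theorem c_a_symm_low {v : V} (h : M.c v ≤ 1 / 4) : M.c (M.a.symm v) = 2 * M.c v := by
  rw [M.c_a_symm, x0Inv, if_pos h]

theorem c_a_symm_mid {v : V} (h : 1 / 4 < M.c v) (h' : M.c v ≤ 1 / 2) :
    M.c (M.a.symm v) = M.c v + 1 / 4 := by
  rw [M.c_a_symm, x0Inv, if_neg h.not_ge, if_pos h']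

theorem c_b_symm_low {v : V} (h : 1 / 2 < M.c v) (h' : M.c v ≤ 5 / 8) :
    M.c (M.b.symm v) = 2 * M.c v - 1 / 2 := by
  rw [M.c_b_symm, x1Inv, if_neg h.not_ge, if_pos h']

theorem c_b_symm_mid {v : V} (h : 5 / 8 < M.c v) (h' : M.c v ≤ 3 / 4) :
    M.c (M.b.symm v) = M.c v + 1 / 8 := by
  rw [M.c_b_symm, x1Inv, if_neg (by linarith), if_neg h.not_ge, if_pos h']

/-! ### Regions recognisable from the unlabelled graph. -/

/-- `σ` preserves adjacency. -/
def PreservesAdj (σ : Equiv.Perm V) : Prop :=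
  ∀ u v, GenAdj (M.c u) (M.c v) → GenAdj (M.c (σ u)) (M.c (σ v))

variable {M} {σ : Equiv.Perm V}

/-- A property of vertices preserved by `σ` and by `σ⁻¹` is invariant. -/
theorem iff_of_forall_preserves {P : V → Prop}
    (h : ∀ τ : Equiv.Perm V, M.PreservesAdj τ → ∀ v, P v → P (τ v))
    (hσ : M.PreservesAdj σ) (hσ' : M.PreservesAdj σ⁻¹) (v : V) : P (σ v) ↔ P v :=
  ⟨fun hv => by simpa using h _ hσ' _ hv, h σ hσ v⟩

theorem low_iff (hσ : M.PreservesAdj σ) (hσ' : M.PreservesAdj σ⁻¹) (v : V) :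
    M.c (σ v) ≤ 1 / 2 ↔ M.c v ≤ 1 / 2 :=
  iff_of_forall_preserves (P := fun v => M.c v ≤ 1 / 2) (fun τ hτ v hv => by
    rw [← GenAdj.self_iff (M.pos _) (M.lt_one _)] at hv ⊢
    exact hτ _ _ hv) hσ hσ' v

/-- Among the points without a loop, those of `(1/2, 3/4]` are the ones with a neighbour that has a
loop. -/
theorem le_three_quarters (hσ : M.PreservesAdj σ) (hσ' : M.PreservesAdj σ⁻¹) {v : V}
    (h : M.c v ≤ 3 / 4) : M.c (σ v) ≤ 3 / 4 := by
  by_cases hv : M.c v ≤ 1 / 2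
  · linarith [(low_iff hσ hσ' v).2 hv]
  have h1 := M.c_a_mid (not_le.1 hv) h
  have h2 := (low_iff hσ hσ' (M.a v)).2 (by linarith)
  exact ((hσ _ _ (M.adj_a v)).eq_of_mid_of_low
    (not_le.1 fun h' => hv ((low_iff hσ hσ' v).1 h')) (M.pos _) h2).1

/-- Among the points above 3/4, those up to 7/8 are the ones with a neighbour in `(1/2, 3/4]`. -/
theorem le_seven_eighths (hσ : M.PreservesAdj σ) (hσ' : M.PreservesAdj σ⁻¹) {v : V}
    (h : M.c v ≤ 7 / 8) : M.c (σ v) ≤ 7 / 8 := by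
  by_cases hv : M.c (σ v) ≤ 3 / 4
  · linarith
  have hv' : 3 / 4 < M.c v := by
    by_contra! hc
    exact hv (le_three_quarters hσ hσ' hc)
  have h1 := M.c_a_high hv'
  have h2 := le_three_quarters hσ hσ' (v := M.a v) (by linarith)
  have h3 : 1 / 2 < M.c (σ (M.a v)) := by
    by_contra! hc
    linarith [(low_iff hσ hσ' _).1 hc]
  exact ((hσ _ _ (M.adj_a v)).symm.of_mid_high h3 h2 (not_le.1 hv)).1

/-- Inside `(1/2, 3/4]`, a point up to 5/8 has two distinct neighbours, its images under `x₁` and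
`x₁⁻¹`; beyond 5/8 the second one leaves the region. -/
theorem le_five_eighths (hσ : M.PreservesAdj σ) (hσ' : M.PreservesAdj σ⁻¹) {v : V}
    (h : M.c v ≤ 5 / 8) : M.c (σ v) ≤ 5 / 8 := by
  by_cases hv : M.c v ≤ 1 / 2
  · linarith [(low_iff hσ hσ' v).2 hv]
  have hl : ∀ w, 1 / 2 < M.c w → 1 / 2 < M.c (σ w) := fun w hw => by
    by_contra! hc
    linarith [(low_iff hσ hσ' _).1 hc]
  rw [not_le] at hv
  have h1 := M.c_b_mid hv (by linarith)
  have h2 := M.c_b_symm_low hv h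
  have hadj := M.adj_b (M.b.symm v)
  rw [Equiv.apply_symm_apply] at hadj
  by_contra! hc
  have h3 := (hσ _ _ (M.adj_b v)).of_mid_mid (hl _ hv)
    (le_three_quarters hσ hσ' (by linarith)) (hl _ (by linarith))
    (le_three_quarters hσ hσ' (by linarith))
  have h4 := (hσ _ _ hadj.symm).of_mid_mid (hl _ hv)
    (le_three_quarters hσ hσ' (by linarith)) (hl _ (by linarith))
    (le_three_quarters hσ hσ' (by linarith))
  have h5 : σ (M.b v) = σ (M.b.symm v) := by
    apply M.inj
    rcases h3 with h3 | h3 <;> rcases h4 with h4 | h4 <;> linarith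
  have h6 := congrArg M.c (σ.injective h5)
  linarith

theorem three_quarters_iff (hσ : M.PreservesAdj σ) (hσ' : M.PreservesAdj σ⁻¹) (v : V) :
    M.c (σ v) ≤ 3 / 4 ↔ M.c v ≤ 3 / 4 :=
  ⟨fun h => by simpa using le_three_quarters hσ' (by simpa using hσ) h, le_three_quarters hσ hσ'⟩

theorem seven_eighths_iff (hσ : M.PreservesAdj σ) (hσ' : M.PreservesAdj σ⁻¹) (v : V) :
    M.c (σ v) ≤ 7 / 8 ↔ M.c v ≤ 7 / 8 :=
  ⟨fun h => by simpa using le_seven_eighths hσ' (by simpa using hσ) h, le_seven_eighths hσ hσ'⟩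

theorem five_eighths_iff (hσ : M.PreservesAdj σ) (hσ' : M.PreservesAdj σ⁻¹) (v : V) :
    M.c (σ v) ≤ 5 / 8 ↔ M.c v ≤ 5 / 8 :=
  ⟨fun h => by simpa using le_five_eighths hσ' (by simpa using hσ) h, le_five_eighths hσ hσ'⟩

/-! ### Recovering the labels near the middle. -/

/-- `σ` commutes with `x₁` on `(1/2, 3/4]`. -/
theorem map_b_mid (hσ : M.PreservesAdj σ) (hσ' : M.PreservesAdj σ⁻¹) {v : V}
    (h : 1 / 2 < M.c v) (h' : M.c v ≤ 3 / 4) : σ (M.b v) = M.b (σ v) := by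
  -- `x₁⁻¹` doubles the distance to 1/2, so `n` bounds the number of steps needed to pass 5/8, where
  -- only one neighbour remains in the region.
  obtain ⟨n, hn⟩ : ∃ n : ℕ, 1 / 8 < 2 ^ n * (M.c v - 1 / 2) := by
    obtain ⟨n, hn⟩ := pow_unbounded_of_one_lt (1 / 8 / (M.c v - 1 / 2)) one_lt_two
    exact ⟨n, by rwa [div_lt_iff₀ (by linarith)] at hn⟩
  have low := low_iff hσ hσ'
  have mid := three_quarters_iff hσ hσ'
  induction n generalizing v with
  | zero =>
    have h1 := M.c_b_mid h h'
    have h2 := (hσ _ _ (M.adj_b v)).of_mid_mid (by grind) (by grind) (by grind) (by grind)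
    have h3 := five_eighths_iff hσ hσ' v
    have h4 := M.c_b_mid (v := σ v) (by grind) (by grind)
    apply M.inj
    grind
  | succ n ih =>
    by_cases h5 : 5 / 8 < M.c v
    · refine ih h h' (hn := ?_)
      have : (1 : ℝ) ≤ 2 ^ n := one_le_pow₀ one_le_two
      nlinarith
    rw [not_lt] at h5
    have hu := M.c_b_symm_low h h5
    have hi := ih (v := M.b.symm v) (by linarith) (by linarith) (by rw [hu]; rw [pow_succ] at hn; linarith)
    rw [Equiv.apply_symm_apply] at hi
    have h1 := M.c_b_mid h h'
    have h2 := (hσ _ _ (M.adj_b v)).of_mid_mid (by grind) (by grind) (by grind) (by grind)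
    have h3 := five_eighths_iff hσ hσ' v
    have h4 := M.c_b_mid (v := σ v) (by grind) (by grind)
    have h6 := M.c_b_mid (v := σ (M.b.symm v)) (by grind) (by grind)
    rw [← hi] at h6
    -- By induction `σ (M.b.symm v)` is the `x₁⁻¹`-neighbour of `σ v`; by injectivity `σ (M.b v)`
    -- must be the other one.
    have h7 : M.c (σ (M.b v)) ≠ M.c (σ (M.b.symm v)) := fun hc => by
      have := congrArg M.c (σ.injective (M.inj hc))
      linarith
    apply M.inj
    grind

/-- If `σ` commutes with `x₀` at a point of `(3/4, 7/8)`, it also commutes with `x₁` there; at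
`7/8`, it commutes with both. -/
theorem map_a_and_b_high_of_map_a (hσ : M.PreservesAdj σ) (hσ' : M.PreservesAdj σ⁻¹) {v : V}
    (h : 3 / 4 < M.c v) (h' : M.c v ≤ 7 / 8) (hfirst : M.c v ≠ 7 / 8 → σ (M.a v) = M.a (σ v)) :
    σ (M.a v) = M.a (σ v) ∧ σ (M.b v) = M.b (σ v) := by
  have low := low_iff hσ hσ'
  have mid := three_quarters_iff hσ hσ'
  have high := seven_eighths_iff hσ hσ'
  have nbrs : ∀ w, 3 / 4 < M.c w → M.c w ≤ 7 / 8 → ∀ u, 1 / 2 < M.c u → M.c u ≤ 3 / 4 →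
      GenAdj (M.c w) (M.c u) → u = M.a w ∨ u = M.b w := by
    intro w hw hw' u hu hu' hadj
    have h1 := (hadj.symm.of_mid_high hu hu' hw).2
    have h2 := M.c_a_high hw
    have h3 := M.c_b_high hw hw'
    rcases h1 with h1 | h1
    · left; apply M.inj; linarith
    · right; apply M.inj; linarith
  have ha := M.c_a_high h
  have hb := M.c_b_high h h'
  have hsv : 3 / 4 < M.c (σ v) := by grind
  have hsv' : M.c (σ v) ≤ 7 / 8 := by grind
  have na := nbrs _ hsv hsv' (σ (M.a v)) (by grind) (by grind) (hσ _ _ (M.adj_a v))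
  have nb := nbrs _ hsv hsv' (σ (M.b v)) (by grind) (by grind) (hσ _ _ (M.adj_b v))
  have ha' := M.c_a_high hsv
  have hb' := M.c_b_high hsv hsv'
  by_cases heq : M.c v = 7 / 8
  · have hab : M.a v = M.b v := M.inj (by linarith)
    -- At 7/8 the two middle neighbours coincide; pulling back by `σ⁻¹` shows that those of `σ v`
    -- coincide too.
    have key : M.a (σ v) = M.b (σ v) := by
      have p1 := hσ' _ _ (M.adj_a (σ v))
      have p2 := hσ' _ _ (M.adj_b (σ v))
      have e1 := σ.apply_symm_apply (M.a (σ v))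
      have e2 := σ.apply_symm_apply (M.b (σ v))
      simp only [Equiv.Perm.inv_def, Equiv.symm_apply_apply] at p1 p2
      have q1 := nbrs v h h' (σ.symm (M.a (σ v))) (by grind) (by grind) p1
      have q2 := nbrs v h h' (σ.symm (M.b (σ v))) (by grind) (by grind) p2
      rw [hab, or_self] at q1 q2
      rw [← e1, ← e2, q1, q2]
    rw [key, or_self] at na nb
    exact ⟨na.trans key.symm, nb⟩
  have hne : M.a v ≠ M.b v := fun hc => by
    have := congrArg M.c hc
    apply heq
    linarith
  refine ⟨hfirst heq, nb.resolve_left fun hc => hne ?_⟩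
  exact σ.injective ((hfirst heq).trans hc.symm)

/-- `σ` commutes with `x₀` and `x₁` on `(3/4, 7/8]`. -/
theorem map_a_and_b_high (hσ : M.PreservesAdj σ) (hσ' : M.PreservesAdj σ⁻¹) {v : V}
    (h : 3 / 4 < M.c v) (h' : M.c v ≤ 7 / 8) :
    σ (M.a v) = M.a (σ v) ∧ σ (M.b v) = M.b (σ v) := by
  refine map_a_and_b_high_of_map_a hσ hσ' h h' fun heq => ?_
  -- The threshold is 7/8 - 13/16: up to 13/16, `x₀` lands in `(1/2, 5/8]`, which the `x₁`-image
  -- avoids, so invariance of 5/8 distinguishes the two.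
  obtain ⟨n, hn⟩ : ∃ n : ℕ, 1 / 16 ≤ 2 ^ n * (7 / 8 - M.c v) := by
    have hlt : 0 < 7 / 8 - M.c v := sub_pos.2 (lt_of_le_of_ne h' heq)
    obtain ⟨n, hn⟩ := pow_unbounded_of_one_lt (1 / 16 / (7 / 8 - M.c v)) one_lt_two
    exact ⟨n, by rw [div_lt_iff₀ hlt] at hn; exact hn.le⟩
  have low := low_iff hσ hσ'
  have mid := three_quarters_iff hσ hσ'
  have mid' := five_eighths_iff hσ hσ'
  have high := seven_eighths_iff hσ hσ'
  induction n generalizing v with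
  | zero =>
    have ha := M.c_a_high h
    have hs := (hσ _ _ (M.adj_a v)).symm.of_mid_high (by grind) (by grind) (by grind)
    have ha' := M.c_a_high (v := σ v) (by grind)
    apply M.inj
    grind
  | succ n ih =>
    have ha := M.c_a_high h
    have hs := (hσ _ _ (M.adj_a v)).symm.of_mid_high (by grind) (by grind) (by grind)
    have ha' := M.c_a_high (v := σ v) (by grind)
    by_cases h5 : M.c (M.a v) ≤ 5 / 8
    · apply M.inj
      grind
    rw [not_le] at h5
    -- This second high neighbour of `M.a v` is twice as far from 7/8 as `v`. By induction `σ`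
    -- respects its `x₁`-edge, so the edge from `σ v` must be the `x₀`-edge.
    have hu := M.c_b_symm_mid h5 (by linarith)
    have hu7 : M.c (M.b.symm (M.a v)) ≤ 7 / 8 := by linarith
    have hu6 : 3 / 4 < M.c (M.b.symm (M.a v)) := by linarith
    have hi := (map_a_and_b_high_of_map_a hσ hσ' hu6 hu7 fun hne =>
      ih hu6 hu7 hne (by rw [hu, ha]; rw [pow_succ] at hn; linarith)).2
    rw [Equiv.apply_symm_apply] at hi
    have h6 := M.c_b_high (v := σ (M.b.symm (M.a v))) (by grind) (by grind)
    rw [← hi] at h6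
    have h7 : M.c (σ v) ≠ M.c (σ (M.b.symm (M.a v))) := fun hc => by
      have := congrArg M.c (σ.injective (M.inj hc))
      apply heq
      linarith
    apply M.inj
    grind

/-! ### Rigidity of the core and its propagation. -/

theorem map_eq_self_mid (hσ : M.PreservesAdj σ) (hσ' : M.PreservesAdj σ⁻¹) {v : V}
    (h : 1 / 2 < M.c v) (h' : M.c v ≤ 3 / 4) : σ v = v := by
  have low := low_iff hσ hσ'
  have mid := three_quarters_iff hσ hσ'
  have high := seven_eighths_iff hσ hσ'
  have bound : ∀ n : ℕ, ∀ v, 1 / 2 < M.c v → M.c v ≤ 3 / 4 →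
      2 ^ n * |M.c (σ v) - M.c v| ≤ 1 := by
    intro n
    induction n with
    | zero =>
      intro v _ _
      rw [pow_zero, one_mul, abs_le]
      constructor <;> linarith [M.pos v, M.lt_one v, M.pos (σ v), M.lt_one (σ v)]
    | succ n ih =>
      intro v h h'
      -- `w` is the image of `v` under the expanding map: `2y - 1/2` up to 5/8, and `2(y + 1/8) - 1`
      -- beyond.
      obtain ⟨w, hw, hw', hd⟩ : ∃ w, 1 / 2 < M.c w ∧ M.c w ≤ 3 / 4 ∧
          M.c (σ w) - M.c w = 2 * (M.c (σ v) - M.c v) := by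
        have hv := M.b.apply_symm_apply v
        by_cases h5 : M.c v ≤ 5 / 8
        · have hu := M.c_b_symm_low h h5
          have e := map_b_mid hσ hσ' (v := M.b.symm v) (by linarith) (by linarith)
          have e' := M.c_b_mid (v := σ (M.b.symm v)) (by grind) (by grind)
          rw [← e, hv] at e'
          exact ⟨M.b.symm v, by linarith, by linarith, by linarith⟩
        · have hu := M.c_b_symm_mid (not_le.1 h5) h'
          have e := map_a_and_b_high hσ hσ' (v := M.b.symm v) (by linarith) (by linarith)
          have e' := M.c_b_high (v := σ (M.b.symm v)) (by grind) (by grind)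
          rw [← e.2, hv] at e'
          have f := M.c_a_high (v := M.b.symm v) (by linarith)
          have f' := M.c_a_high (v := σ (M.b.symm v)) (by grind)
          rw [← e.1] at f'
          exact ⟨M.a (M.b.symm v), by linarith, by linarith, by linarith⟩
      have := ih w hw hw'
      rw [hd, abs_mul, abs_two] at this
      rw [pow_succ]
      linarith
  by_contra hne
  have hpos : 0 < |M.c (σ v) - M.c v| := abs_pos.2 (sub_ne_zero.2 fun hc => hne (M.inj hc))
  obtain ⟨n, hn⟩ := pow_unbounded_of_one_lt (1 / |M.c (σ v) - M.c v|) one_lt_two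
  rw [div_lt_iff₀ hpos] at hn
  linarith [bound n v h h']

theorem map_eq_self_of_gt_half (hσ : M.PreservesAdj σ) (hσ' : M.PreservesAdj σ⁻¹) {v : V}
    (h : 1 / 2 < M.c v) : σ v = v := by
  have low := low_iff hσ hσ'
  have mid := three_quarters_iff hσ hσ'
  have high := seven_eighths_iff hσ hσ'
  have base : ∀ w, 1 / 2 < M.c w → M.c w ≤ 7 / 8 → σ w = w := by
    intro w hw hw'
    by_cases hw6 : M.c w ≤ 3 / 4
    · exact map_eq_self_mid hσ hσ' hw hw6
    have e := (map_a_and_b_high hσ hσ' (not_le.1 hw6) hw').1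
    have ha := M.c_a_high (not_le.1 hw6)
    rw [map_eq_self_mid hσ hσ' (v := M.a w) (by linarith) (by linarith)] at e
    exact (M.a.injective e).symm
  obtain ⟨n, hn⟩ : ∃ n : ℕ, 1 / 8 < 2 ^ n * (1 - M.c v) := by
    have hlt : 0 < 1 - M.c v := sub_pos.2 (M.lt_one v)
    obtain ⟨n, hn⟩ := pow_unbounded_of_one_lt (1 / 8 / (1 - M.c v)) one_lt_two
    exact ⟨n, by rwa [div_lt_iff₀ hlt] at hn⟩
  induction n generalizing v with
  | zero => exact base v h (by linarith)
  | succ n ih =>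
    by_cases h7 : M.c v ≤ 7 / 8
    · exact base v h h7
    rw [not_le] at h7
    have ha := M.c_a_high (v := v) (by linarith)
    have hz := ih (v := M.a v) (by linarith) (by rw [ha]; rw [pow_succ] at hn; linarith)
    have hadj := hσ _ _ (M.adj_a v)
    rw [hz] at hadj
    have hs := hadj.symm.of_high_high (by linarith) (by grind)
    -- `σ v` is a high neighbour of the fixed point `M.a v`. It cannot be the next point of the ray,
    -- `M.a (M.a v)`, since that is itself fixed.
    rcases hs with hs | hs
    · have ha2 := M.c_a_high (v := M.a v) (by linarith)
      have hp : (1 : ℝ) ≤ 2 ^ n := one_le_pow₀ one_le_two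
      have hz2 : σ (M.a (M.a v)) = M.a (M.a v) := by
        refine ih (by grind) ?_
        rw [ha2, ha]
        rw [pow_succ] at hn
        nlinarith [M.lt_one v]
      have : σ v = σ (M.a (M.a v)) := by rw [hz2]; exact M.inj (hs.trans ha2.symm)
      linarith [congrArg M.c (σ.injective this), M.lt_one v]
    · exact M.inj (by linarith)

theorem map_eq_self (hσ : M.PreservesAdj σ) (hσ' : M.PreservesAdj σ⁻¹) (v : V) : σ v = v := by
  have low := low_iff hσ hσ'
  obtain ⟨n, hn⟩ : ∃ n : ℕ, 1 / 2 < 2 ^ n * M.c v := by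
    obtain ⟨n, hn⟩ := pow_unbounded_of_one_lt (1 / 2 / M.c v) one_lt_two
    exact ⟨n, by rwa [div_lt_iff₀ (M.pos v)] at hn⟩
  induction n generalizing v with
  | zero => exact map_eq_self_of_gt_half hσ hσ' (by linarith)
  | succ n ih =>
    by_cases h : 1 / 2 < M.c v
    · exact map_eq_self_of_gt_half hσ hσ' h
    rw [not_lt] at h
    have hadj := M.adj_a (M.a.symm v)
    rw [Equiv.apply_symm_apply] at hadj
    have hadj := hσ _ _ hadj
    by_cases h4 : M.c v ≤ 1 / 4
    · have hz := M.c_a_symm_low h4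
      have hfix := ih (M.a.symm v) (by rw [hz]; rw [pow_succ] at hn; linarith)
      rw [hfix] at hadj
      rcases hadj.of_low_low (by linarith) (by grind) with hs | hs | hs
      · have := σ.injective ((M.inj hs).trans hfix.symm)
        rw [← this] at hz
        linarith [M.pos v]
      · exact M.inj (by linarith)
      -- Here `σ v` would be `4v`, which the induction hypothesis fixes; injectivity then gives `σ v
      -- = v`, impossible.
      · have hp : (1 : ℝ) ≤ 2 ^ n := one_le_pow₀ one_le_two
        have hfix2 := ih (σ v) (by
          rw [hs, hz]
          rw [pow_succ] at hn
          nlinarith [M.pos v])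
        rw [σ.injective hfix2, hz] at hs
        linarith [M.pos v]
    -- The fixed point `v + 1/4` of the core has a single neighbour in the lower half.
    · have hz := M.c_a_symm_mid (not_le.1 h4) h
      rw [map_eq_self_of_gt_half hσ hσ' (v := M.a.symm v) (by linarith)] at hadj
      exact M.inj (by linarith [(hadj.eq_of_mid_of_low (by linarith) (M.pos _) (by grind)).2])

end GenModel

/-! ### Application to the Schreier graphs. -/

/-- The model given by the orbit of a point of `(0, 1)` under Thompson's group. -/
noncomputable def orbitModel (x : unitInterval) (hx0 : 0 < x) (hx1 : x < 1) :
    GenModel (MulAction.orbit thompsonF x) where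
  c v := (v.1 : ℝ)
  a := MulAction.toPerm genX0
  b := MulAction.toPerm genX1
  inj := fun u v h => Subtype.ext (Subtype.ext h)
  pos := by
    rintro ⟨_, g, rfl⟩
    have h : g.1 0 < g.1 x := g.2.1 hx0
    exact (unitInterval.nonneg' (t := g.1 0)).trans_lt h
  lt_one := by
    rintro ⟨_, g, rfl⟩
    have h : g.1 x < g.1 1 := g.2.1 hx1
    exact h.trans_le (unitInterval.le_one' (t := g.1 1))
  c_a _ := rfl
  c_b _ := rfl

theorem genAdj_iff_exists_endpoints (x : unitInterval) (u v : MulAction.orbit thompsonF x) :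
    GenAdj (u.1 : ℝ) (v.1 : ℝ) ↔ ∃ e, (thompsonSchreier x).endpoints e = s(u, v) := by
  have key : ∀ (u v : MulAction.orbit thompsonF x),
      ((v.1 : ℝ) = x0Fun (u.1 : ℝ) ↔ genX0 • u = v) ∧
      ((v.1 : ℝ) = x1Fun (u.1 : ℝ) ↔ genX1 • u = v) := fun u v =>
    ⟨⟨fun h => Subtype.ext (Subtype.ext h.symm), fun h => by rw [← h]; rfl⟩,
      ⟨fun h => Subtype.ext (Subtype.ext h.symm), fun h => by rw [← h]; rfl⟩⟩
  unfold GenAdj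
  rw [(key u v).1, (key u v).2, (key v u).1, (key v u).2]
  constructor
  · rintro (h | h | h | h)
    · exact ⟨(u, 0), by rw [← h]; rfl⟩
    · exact ⟨(v, 0), by rw [← h]; exact Sym2.eq_swap⟩
    · exact ⟨(u, 1), by rw [← h]; rfl⟩
    · exact ⟨(v, 1), by rw [← h]; exact Sym2.eq_swap⟩
  · rintro ⟨⟨w, i⟩, h⟩
    fin_cases i
    · replace h : s(w, genX0 • w) = s(u, v) := h
      rcases Sym2.eq_iff.1 h with ⟨rfl, h'⟩ | ⟨rfl, h'⟩
      · exact Or.inl h'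
      · exact Or.inr (Or.inl h')
    · replace h : s(w, genX1 • w) = s(u, v) := h
      rcases Sym2.eq_iff.1 h with ⟨rfl, h'⟩ | ⟨rfl, h'⟩
      · exact Or.inr (Or.inr (Or.inl h'))
      · exact Or.inr (Or.inr (Or.inr h'))

theorem preservesAdj_of_mem_unmarkedAut {x : unitInterval} (hx0 : 0 < x) (hx1 : x < 1)
    {σ : Equiv.Perm (MulAction.orbit thompsonF x)}
    (hσ : σ ∈ (thompsonSchreier x).unmarkedAut) : (orbitModel x hx0 hx1).PreservesAdj σ := by
  obtain ⟨τ, hτ⟩ := hσ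
  intro u v huv
  obtain ⟨e, he⟩ := (genAdj_iff_exists_endpoints x u v).1 huv
  exact (genAdj_iff_exists_endpoints x (σ u) (σ v)).2 ⟨τ e, by rw [hτ, he, Sym2.map_mk]⟩

theorem LabelledDigraph.markedAut_le_unmarkedAut {V E L : Type*} (Γ : LabelledDigraph V E L) :
    Γ.markedAut ≤ Γ.unmarkedAut := by
  rintro σ ⟨τ, hτ⟩
  exact ⟨τ, fun e => by simp [LabelledDigraph.endpoints, hτ]⟩

theorem mainTheorem9 (x : unitInterval) (hx0 : 0 < x) (hx1 : x < 1) :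
    (thompsonSchreier x).markedAut = ⊥ ∧ (thompsonSchreier x).unmarkedAut = ⊥ := by
  have h : (thompsonSchreier x).unmarkedAut = ⊥ := by
    refine (Subgroup.eq_bot_iff_forall _).2 fun σ hσ => Equiv.ext fun v => ?_
    exact GenModel.map_eq_self (preservesAdj_of_mem_unmarkedAut hx0 hx1 hσ)
      (preservesAdj_of_mem_unmarkedAut hx0 hx1 (inv_mem hσ)) v
  exact ⟨le_bot_iff.1 (h ▸ LabelledDigraph.markedAut_le_unmarkedAut _), h⟩
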